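/- Binary feedback model. There are $m$ experts $C=\{1,\dots,m\}$. An instance consists of a probability distribution $\mathcal D$ on a space of tasks and (measurable) feedback bits $u(d,c)\in\{0,1\}$ for each task $d$ and expert $c$. For $S\subseteq C$ let $v(S)=\Pr_{d\sim\mathcal D}[\exists c\in S:\ u(d,c)=1]$, and let $\mathrm{OPT}_1=\max_{c\in C}v(\{c\})$. An adaptive algorithm, which does not know the instance, has access to tasks $d_0,d_1,\dots$ drawn i.i.d. from $\mathcal D$ only as handles: in each step it either makes an oracle call $(t,c)$, which reveals the bit $u(d_t,c)$, or stops and returns an expert $\widehat c\in C$; it chooses each step from the calls and answers so far and from private randomness that is independent of the tasks. Every oracle call counts as one query; a run that never stops makes infinitely many queries and does not count as successful. The worst-case expected query complexity of the algorithm is the supremum over all instances of its expected number of queries. **Theorem.** There is a universal constant $K>0$ such that the following holds for all $m\ge 2$ and $0<\varepsilon\le 1/8$. Every adaptive algorithm that, on every instance, with probability at least $2/3$ returns an expert $\widehat c\in C$ with $v(\{\widehat c\})\ge \mathrm{OPT}_1-\varepsilon$ has worst-case expected query complexity at least $K\,m/\varepsilon^2$. -/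

import Mathlib

open MeasureTheory
open scoped ENNReal

/-- An instance of the binary feedback model with the `m` experts `Fin m`: a space of tasks, a
task distribution, and the feedback bits `u d c`, where `u d c = true` means that expert `c`
solves task `d`. -/
structure BinaryInstance (m : ℕ) where
  Task : Type
  [measurableSpace : MeasurableSpace Task]
  taskLaw : Measure Task
  [isProbabilityMeasure : IsProbabilityMeasure taskLaw]
  u : Task → Fin m → Bool
  measurable_u : ∀ c, Measurable fun d => u d c

attribute [instance] BinaryInstance.measurableSpace BinaryInstance.isProbabilityMeasure

namespace BinaryInstance

/-- The coverage `v(S)`: the probability that some expert in `S` solves a random task. -/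
noncomputable def coverage {m : ℕ} (I : BinaryInstance m) (S : Finset (Fin m)) : ℝ :=
  I.taskLaw.real {d | ∃ c ∈ S, I.u d c = true}

/-- `OPT_k`: the maximal coverage of a committee of exactly `k` experts (a maximum over a finite
set, nonempty for `k ≤ m`). -/
noncomputable def opt {m : ℕ} (I : BinaryInstance m) (k : ℕ) : ℝ :=
  ⨆ S : {S : Finset (Fin m) // S.card = k}, I.coverage S.1

end BinaryInstance

/-- What an algorithm can do next: `Sum.inl (t, c)` is the oracle call for expert `c` on the
`t`-th sampled task, `Sum.inr c` is to stop and return expert `c`. -/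
abbrev QueryAction (m : ℕ) : Type := (ℕ × Fin m) ⊕ Fin m

/-- The feedback observed so far: the list of all oracle calls made, with their answers. -/
abbrev Transcript (m : ℕ) : Type := List ((ℕ × Fin m) × Bool)

/-- A randomized adaptive algorithm. It draws a private random seed, and chooses each action from
the seed and the transcript so far. Sampled tasks are accessible only as handles `t : ℕ`, through
oracle calls; any task may be stored and queried later, and calls may be repeated. There is no bound
on the number of calls and the algorithm need not terminate. -/
structure AdaptiveAlgorithm (m : ℕ) where
  Seed : Type
  [measurableSpace : MeasurableSpace Seed]
  seedLaw : Measure Seed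
  [isProbabilityMeasure : IsProbabilityMeasure seedLaw]
  next : Seed → Transcript m → QueryAction m
  measurable_next : ∀ h, Measurable fun s => next s h

attribute [instance] AdaptiveAlgorithm.measurableSpace AdaptiveAlgorithm.isProbabilityMeasure

namespace AdaptiveAlgorithm

variable {m : ℕ}

/-- The transcript after at most `n` oracle calls, for the seed `s`, when the oracle answers
`ans t c` to the call `(t, c)`. It no longer changes once the algorithm has stopped. -/
def transcript (A : AdaptiveAlgorithm m) (s : A.Seed) (ans : ℕ → Fin m → Bool) :
    ℕ → Transcript m
  | 0 => []
  | n + 1 =>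
    let h := A.transcript s ans n
    match A.next s h with
    | Sum.inl q => h ++ [(q, ans q.1 q.2)]
    | Sum.inr _ => h

/-- The algorithm stops after finitely many oracle calls and returns the expert `c`. -/
def Returns (A : AdaptiveAlgorithm m) (s : A.Seed) (ans : ℕ → Fin m → Bool) (c : Fin m) : Prop :=
  ∃ n, A.next s (A.transcript s ans n) = Sum.inr c

/-- The total number of oracle calls; it is `∞` if the algorithm does not stop. -/
noncomputable def queryCount (A : AdaptiveAlgorithm m) (s : A.Seed) (ans : ℕ → Fin m → Bool) :
    ℝ≥0∞ :=
  ⨆ n, ((A.transcript s ans n).length : ℝ≥0∞)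

/-- The joint law of the private seed and of the sampled tasks, which are i.i.d. from the task
distribution and independent of the seed. -/
noncomputable def runLaw (A : AdaptiveAlgorithm m) (I : BinaryInstance m) :
    Measure (A.Seed × (ℕ → I.Task)) :=
  A.seedLaw.prod (Measure.infinitePi fun _ : ℕ => I.taskLaw)

/-- The probability that the algorithm stops and returns a single expert `c` with
`v({c}) ≥ OPT_1 - ε`. -/
noncomputable def successProb (A : AdaptiveAlgorithm m) (I : BinaryInstance m) (ε : ℝ) : ℝ :=
  (A.runLaw I).real
    {ω | ∃ c, A.Returns ω.1 (fun t => I.u (ω.2 t)) c ∧ I.opt 1 - ε ≤ I.coverage {c}}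

/-- The expected number of oracle calls on the instance `I`. -/
noncomputable def expectedQueries (A : AdaptiveAlgorithm m) (I : BinaryInstance m) : ℝ≥0∞ :=
  ∫⁻ ω, A.queryCount ω.1 (fun t => I.u (ω.2 t)) ∂(A.runLaw I)

/-- The worst-case expected query complexity: the supremum over all instances. -/
noncomputable def worstCaseQueries (A : AdaptiveAlgorithm m) : ℝ≥0∞ :=
  ⨆ I : BinaryInstance m, A.expectedQueries I

end AdaptiveAlgorithm

/-!
The hard instances have independent feedback bits. In the base instance every expert is a fair coin;
in the instance that hides expert `c`, that expert has bias `1 / 2 + 2 * ε` instead, so it is the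
only acceptable output. A successful algorithm returns `c` with probability at least `2 / 3` when
`c` is hidden, whereas on the base instance the probabilities of returning the various experts sum to
at most `1`. For most experts the two instances must therefore be told apart, and this takes order
`1 / ε ^ 2` queries to that expert, already in expectation on the base instance.

The comparison of two instances is `measureReal_iterate_le`. For a fixed seed the algorithm is a
binary decision tree, and the probability of reaching a node is the `weight` of its transcript, a
cylinder probability; a repeated oracle call has a known answer, and a new one has an answer
independent of the transcript, although queries may mix tasks and experts arbitrarily. The
log-likelihood ratio of the two instances, less `11 * ε ^ 2` for each query to the hidden expert, is
a supermartingale (`entropy_superharmonic`), so that expected queries bound the relative entropy of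
the transcripts, which bounds the change in probability of any event by a linearized form of
Pinsker's inequality (`one_sub_le_add_div`). Being linear, the bound can be averaged over the seed
(`prod_measure_stops_le`) and summed over all experts: the costs of the queries to the various
experts add up to the total number of queries, which gives the factor `m` with no choice of a
particular expert.

Only finitely many steps are compared: monotone convergence provides a number of steps within which
every hidden expert is found with probability at least `5 / 8`
(`exists_forall_measure_stops_ge`), and the length of a truncated transcript is at most the query
count.
-/

/-! ### Independent biased bits and cylinder probabilities -/

/-- The law of the table of feedback bits when expert `c` solves each task with probability `p c`,
independently over all tasks and experts. A task is the vector of its own feedback bits. -/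
noncomputable def oracleLaw {m : ℕ} (p : Fin m → unitInterval) : Measure (ℕ → Fin m → Bool) :=
  Measure.infinitePi fun _ =>
    Measure.pi fun c => ProbabilityTheory.bernoulliMeasure true false (p c)

instance {m : ℕ} (p : Fin m → unitInterval) : IsProbabilityMeasure (oracleLaw p) := by
  unfold oracleLaw; infer_instance

/-- The tables of feedback bits that agree with every answer recorded in the transcript `h`. -/
def agreeSet {m : ℕ} (h : Transcript m) : Set (ℕ → Fin m → Bool) :=
  {ω | ∀ x ∈ h, ω x.1.1 x.1.2 = x.2}

/-- The bits for expert `c` on task `t` that do not contradict the transcript `h`. -/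
def allowedBits {m : ℕ} (h : Transcript m) (t : ℕ) (c : Fin m) : Set Bool :=
  {b | ∀ x ∈ h, x.1 = (t, c) → b = x.2}

/-- The probability of the bit `b` under bias `p`. -/
def bitProb (p : unitInterval) (b : Bool) : ℝ := if b then p else 1 - p

/-- The probability that the oracle's answers agree with the transcript `h`. -/
noncomputable def weight {m : ℕ} (p : Fin m → unitInterval) (h : Transcript m) : ℝ :=
  (oracleLaw p).real (agreeSet h)

section Weight

variable {m : ℕ}

lemma agreeSet_append (h : Transcript m) (q : ℕ × Fin m) (b : Bool) :
    agreeSet (h ++ [(q, b)]) = agreeSet h ∩ {ω | ω q.1 q.2 = b} := by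
  ext ω
  simp [agreeSet, or_imp, forall_and]

lemma measurableSet_eval_eq (q : ℕ × Fin m) (b : Bool) :
    MeasurableSet {ω : ℕ → Fin m → Bool | ω q.1 q.2 = b} := by
  have : Measurable fun ω : ℕ → Fin m → Bool => ω q.1 q.2 := by fun_prop
  exact this (measurableSet_singleton b)

lemma measurableSet_agreeSet (h : Transcript m) : MeasurableSet (agreeSet h) := by
  have : agreeSet h = ⋂ x ∈ {x | x ∈ h}, {ω | ω x.1.1 x.1.2 = x.2} := by
    ext ω; simp [agreeSet]
  rw [this]
  exact MeasurableSet.biInter (Set.to_countable _) fun x _ => measurableSet_eval_eq _ _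

lemma weight_nonneg (p : Fin m → unitInterval) (h : Transcript m) : 0 ≤ weight p h :=
  measureReal_nonneg

@[simp] lemma weight_nil (p : Fin m → unitInterval) : weight p [] = 1 := by
  simp [weight, agreeSet]

lemma weight_append_add (p : Fin m → unitInterval) (h : Transcript m) (q : ℕ × Fin m) :
    weight p (h ++ [(q, true)]) + weight p (h ++ [(q, false)]) = weight p h := by
  have := measureReal_inter_add_sdiff (μ := oracleLaw p) (s := agreeSet h)
    (measurableSet_eval_eq q true)
  rw [weight, weight, weight, ← this, agreeSet_append, agreeSet_append]
  congr 2
  ext ω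
  simp

lemma agreeSet_eq_pi (h : Transcript m) {T : Finset ℕ} (hT : ∀ x ∈ h, x.1.1 ∈ T) :
    agreeSet h = Set.pi (T : Set ℕ) fun t => Set.pi Set.univ (allowedBits h t) := by
  ext ω
  simp only [agreeSet, allowedBits, Set.mem_pi, Set.mem_ofPred_eq, Set.mem_univ, true_imp_iff]
  constructor
  · intro H t _ c x hx e
    have := H x hx
    rwa [e] at this
  · intro H x hx
    exact H x.1.1 (hT x hx) x.1.2 x hx rfl

lemma weight_eq_prod (p : Fin m → unitInterval) (h : Transcript m) {T : Finset ℕ}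
    (hT : ∀ x ∈ h, x.1.1 ∈ T) :
    weight p h = ∏ x ∈ T ×ˢ Finset.univ,
      (ProbabilityTheory.bernoulliMeasure true false (p x.2)).real (allowedBits h x.1 x.2) := by
  rw [weight, agreeSet_eq_pi h hT, oracleLaw, measureReal_def, Measure.infinitePi_pi]
  · simp only [Measure.pi_pi, Finset.prod_product, ENNReal.toReal_prod, measureReal_def]
  · exact fun t _ => MeasurableSet.univ_pi fun c => MeasurableSet.of_discrete

lemma bernoulliMeasure_real_singleton (p : unitInterval) (b : Bool) :
    (ProbabilityTheory.bernoulliMeasure true false p).real {b} = bitProb p b := by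
  rw [ProbabilityTheory.bernoulliMeasure_real_apply p (MeasurableSet.of_discrete)]
  cases b <;> simp [bitProb]

/-- An oracle call that was not made before has an answer independent of the transcript. -/
lemma weight_append_of_notMem (p : Fin m → unitInterval) (h : Transcript m) (q : ℕ × Fin m)
    (hq : ∀ b, (q, b) ∉ h) (b : Bool) :
    weight p (h ++ [(q, b)]) = weight p h * bitProb (p q.2) b := by
  classical
  set T : Finset ℕ := insert q.1 (h.map fun x => x.1.1).toFinset with hTdef
  have hT : ∀ x ∈ h, x.1.1 ∈ T := fun x hx =>
    Finset.mem_insert_of_mem (List.mem_toFinset.2 (List.mem_map_of_mem hx))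
  have hT' : ∀ x ∈ h ++ [(q, b)], x.1.1 ∈ T := by
    intro x hx
    rcases List.mem_append.1 hx with hx | hx
    · exact hT x hx
    · rw [List.mem_singleton.1 hx]
      exact Finset.mem_insert_self _ _
  rw [weight_eq_prod p h hT, weight_eq_prod p _ hT']
  have key : ∀ x : ℕ × Fin m,
      (ProbabilityTheory.bernoulliMeasure true false (p x.2)).real
        (allowedBits (h ++ [(q, b)]) x.1 x.2) =
      (ProbabilityTheory.bernoulliMeasure true false (p x.2)).real (allowedBits h x.1 x.2) *
        if x = q then bitProb (p q.2) b else 1 := by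
    intro x
    split_ifs with hx
    · subst hx
      have h1 : allowedBits h x.1 x.2 = Set.univ := by
        ext b'
        simp only [allowedBits, Set.mem_ofPred_eq, Set.mem_univ, iff_true]
        rintro ⟨y, b''⟩ hy rfl
        exact absurd hy (hq b'')
      have h2 : allowedBits (h ++ [(x, b)]) x.1 x.2 = {b} := by
        ext b'
        simp only [allowedBits, Set.mem_ofPred_eq, Set.mem_singleton_iff]
        constructor
        · intro H
          exact H (x, b) (by simp) rfl
        · rintro rfl ⟨y, b''⟩ hy rfl
          rcases List.mem_append.1 hy with hy | hy
          · exact absurd hy (hq b'')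
          · simpa using (List.mem_singleton.1 hy).symm
      rw [h1, h2, probReal_univ, one_mul, bernoulliMeasure_real_singleton]
    · have : allowedBits (h ++ [(q, b)]) x.1 x.2 = allowedBits h x.1 x.2 := by
        ext b'
        simp [allowedBits, or_imp, forall_and, Ne.symm hx]
      rw [this, mul_one]
  rw [Finset.prod_congr rfl fun x _ => key x, Finset.prod_mul_distrib, Finset.prod_ite_eq',
    if_pos]
  simp [hTdef]

/-- The answer to a repeated oracle call is known: one continuation has the same weight and the
other has weight zero. -/
lemma weight_append_of_mem (p : Fin m → unitInterval) (h : Transcript m) (q : ℕ × Fin m)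
    {b : Bool} (hq : (q, b) ∈ h) :
    weight p (h ++ [(q, b)]) = weight p h ∧ weight p (h ++ [(q, !b)]) = 0 := by
  have h1 : agreeSet (h ++ [(q, b)]) = agreeSet h := by
    rw [agreeSet_append, Set.inter_eq_left]
    exact fun ω hω => hω _ hq
  have h2 : agreeSet (h ++ [(q, !b)]) = ∅ := by
    rw [agreeSet_append]
    ext ω
    simp only [Set.mem_inter_iff, Set.mem_ofPred_eq, Set.mem_empty_iff_false, iff_false, not_and]
    intro hω
    have : ω q.1 q.2 = b := hω _ hq
    simp [this]
  simp [weight, h1, h2]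

/-- With all biases strictly between `0` and `1`, every consistent transcript has positive weight,
so that all such laws charge the same transcripts. -/
lemma weight_pos {p p' : Fin m → unitInterval} (hp' : ∀ c b, 0 < bitProb (p' c) b)
    {h : Transcript m} (hw : weight p h ≠ 0) : 0 < weight p' h := by
  have hne : (agreeSet h).Nonempty := by
    rw [Set.nonempty_iff_ne_empty]
    intro e
    simp [weight, e] at hw
  obtain ⟨ω, hω⟩ := hne
  have hT : ∀ x ∈ h, x.1.1 ∈ (h.map fun x => x.1.1).toFinset := fun x hx =>
    List.mem_toFinset.2 (List.mem_map_of_mem hx)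
  rw [weight_eq_prod p' h hT]
  refine Finset.prod_pos fun x _ => ?_
  refine (hp' x.2 (ω x.1 x.2)).trans_le ?_
  rw [← bernoulliMeasure_real_singleton]
  refine measureReal_mono ?_
  rintro _ rfl y hy e
  have := hω y hy
  rw [e] at this
  exact this

end Weight

/-! ### Deterministic strategies as decision trees -/

section Strategy

variable {m : ℕ}

/-- One step of the deterministic strategy `f` against the oracle `ω`. -/
def advance (f : Transcript m → QueryAction m) (ω : ℕ → Fin m → Bool) (h : Transcript m) :
    Transcript m :=
  match f h with
  | Sum.inl q => h ++ [(q, ω q.1 q.2)]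
  | Sum.inr _ => h

lemma AdaptiveAlgorithm.transcript_eq_iterate (A : AdaptiveAlgorithm m) (s : A.Seed)
    (ω : ℕ → Fin m → Bool) (n : ℕ) :
    A.transcript s ω n = (advance (A.next s) ω)^[n] [] := by
  induction n with
  | zero => rfl
  | succ n ih =>
    rw [Function.iterate_succ_apply', ← ih]
    rfl

/-- The sum of `F` over the transcripts that the strategy `f` can reach from `h` in `n` steps, both
answers to each oracle call being followed. -/
def treeSum (f : Transcript m → QueryAction m) :
    ℕ → (Transcript m → ℝ) → Transcript m → ℝ
  | 0, F, h => F h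
  | n + 1, F, h =>
    match f h with
    | Sum.inl q => treeSum f n F (h ++ [(q, true)]) + treeSum f n F (h ++ [(q, false)])
    | Sum.inr _ => F h

lemma treeSum_sub (f : Transcript m → QueryAction m) (n : ℕ) (F G : Transcript m → ℝ)
    (h : Transcript m) :
    treeSum f n (F - G) h = treeSum f n F h - treeSum f n G h := by
  induction n generalizing h with
  | zero => rfl
  | succ n ih =>
    simp only [treeSum]
    cases f h with
    | inl q => simp only [ih]; ring
    | inr c => rfl

lemma treeSum_mono (f : Transcript m → QueryAction m) (n : ℕ) {F G : Transcript m → ℝ}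
    (hFG : ∀ h, F h ≤ G h) (h : Transcript m) : treeSum f n F h ≤ treeSum f n G h := by
  induction n generalizing h with
  | zero => exact hFG h
  | succ n ih =>
    simp only [treeSum]
    cases f h with
    | inl q => exact add_le_add (ih _) (ih _)
    | inr c => exact hFG h

/-- A potential that does not increase, in sum over the two answers, at any oracle call bounds its
sum over the leaves of every decision tree. -/
lemma treeSum_le_of_superharmonic (f : Transcript m → QueryAction m) (n : ℕ)
    {F : Transcript m → ℝ}
    (hF : ∀ h q, F (h ++ [(q, true)]) + F (h ++ [(q, false)]) ≤ F h) (h : Transcript m) :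
    treeSum f n F h ≤ F h := by
  induction n generalizing h with
  | zero => exact le_rfl
  | succ n ih =>
    simp only [treeSum]
    cases f h with
    | inl q => exact (add_le_add (ih _) (ih _)).trans (hF h q)
    | inr c => exact le_rfl

/-- The expectation of a function of the `n`-step transcript is its weighted sum over the leaves of
the decision tree; no measurability of `G` is needed since only finitely many transcripts occur. -/
lemma integrableOn_and_setIntegral_iterate (p : Fin m → unitInterval)
    (f : Transcript m → QueryAction m) (G : Transcript m → ℝ) (n : ℕ) (h : Transcript m) :
    IntegrableOn (fun ω => G ((advance f ω)^[n] h)) (agreeSet h) (oracleLaw p) ∧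
      ∫ ω in agreeSet h, G ((advance f ω)^[n] h) ∂(oracleLaw p) =
        treeSum f n (fun h => weight p h * G h) h := by
  induction n generalizing h with
  | zero =>
    simp [treeSum, weight]
  | succ n ih =>
    cases hf : f h with
    | inr c =>
      have hfix : ∀ ω, (advance f ω)^[n + 1] h = h := fun ω =>
        Function.iterate_fixed (by simp [advance, hf]) _
      simp [treeSum, hf, hfix, weight]
    | inl q =>
      have hsplit : agreeSet h = agreeSet (h ++ [(q, true)]) ∪ agreeSet (h ++ [(q, false)]) := by
        rw [agreeSet_append, agreeSet_append, ← Set.inter_union_distrib_left, eq_comm,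
          Set.inter_eq_left]
        intro ω _
        cases hb : ω q.1 q.2 <;> simp [hb]
      have hdisj : Disjoint (agreeSet (h ++ [(q, true)])) (agreeSet (h ++ [(q, false)])) := by
        rw [agreeSet_append, agreeSet_append, Set.disjoint_left]
        rintro ω ⟨_, h1⟩ ⟨_, h2⟩
        simp only [Set.mem_ofPred_eq] at h1 h2
        simp [h1] at h2
      have hstep : ∀ b, Set.EqOn (fun ω => G ((advance f ω)^[n] (h ++ [(q, b)])))
          (fun ω => G ((advance f ω)^[n + 1] h)) (agreeSet (h ++ [(q, b)])) := by
        intro b ω hω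
        rw [agreeSet_append] at hω
        have : ω q.1 q.2 = b := hω.2
        simp [Function.iterate_succ_apply, advance, hf, this]
      have hint : ∀ b, IntegrableOn (fun ω => G ((advance f ω)^[n + 1] h))
          (agreeSet (h ++ [(q, b)])) (oracleLaw p) := fun b =>
        ((ih (h ++ [(q, b)])).1).congr_fun (hstep b) (measurableSet_agreeSet _)
      constructor
      · rw [hsplit]
        exact (hint true).union (hint false)
      · rw [hsplit, setIntegral_union hdisj (measurableSet_agreeSet _) (hint true) (hint false),
          ← setIntegral_congr_fun (measurableSet_agreeSet _) (hstep true),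
          ← setIntegral_congr_fun (measurableSet_agreeSet _) (hstep false),
          (ih _).2, (ih _).2]
        simp [treeSum, hf]

lemma integrable_iterate (p : Fin m → unitInterval) (f : Transcript m → QueryAction m)
    (G : Transcript m → ℝ) (n : ℕ) :
    Integrable (fun ω => G ((advance f ω)^[n] [])) (oracleLaw p) := by
  have := (integrableOn_and_setIntegral_iterate p f G n []).1
  simpa [agreeSet] using this

lemma integral_iterate (p : Fin m → unitInterval) (f : Transcript m → QueryAction m)
    (G : Transcript m → ℝ) (n : ℕ) :
    ∫ ω, G ((advance f ω)^[n] []) ∂(oracleLaw p) =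
      treeSum f n (fun h => weight p h * G h) [] := by
  have := (integrableOn_and_setIntegral_iterate p f G n []).2
  simpa [agreeSet] using this

end Strategy

/-! ### Change of measure under adaptive queries -/

section ChangeOfMeasure

variable {m : ℕ}

/-- The total cost of the oracle calls in a transcript, where a call for expert `c` costs `κ c`. -/
def cost (κ : Fin m → ℝ) (h : Transcript m) : ℝ := (h.map fun x => κ x.1.2).sum

lemma cost_append (κ : Fin m → ℝ) (h : Transcript m) (q : ℕ × Fin m) (b : Bool) :
    cost κ (h ++ [(q, b)]) = cost κ h + κ q.2 := by
  simp [cost]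

lemma bitProb_add (p : unitInterval) : bitProb p true + bitProb p false = 1 := by
  simp [bitProb]

/-- If `κ c` bounds the relative entropy of the bits of expert `c` under the biases `p` with respect
to `p'`, then the log-likelihood ratio minus the cost is a supermartingale under `p`. A repeated
call is harmless: it costs something and reveals nothing. -/
lemma entropy_superharmonic {p p' : Fin m → unitInterval} {κ : Fin m → ℝ}
    (hp : ∀ c b, 0 < bitProb (p c) b) (hp' : ∀ c b, 0 < bitProb (p' c) b) (hκ : ∀ c, 0 ≤ κ c)
    (hkl : ∀ c, bitProb (p c) true * Real.log (bitProb (p c) true / bitProb (p' c) true) +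
      bitProb (p c) false * Real.log (bitProb (p c) false / bitProb (p' c) false) ≤ κ c)
    (h : Transcript m) (q : ℕ × Fin m) :
    weight p (h ++ [(q, true)]) *
        (Real.log (weight p (h ++ [(q, true)]) / weight p' (h ++ [(q, true)])) -
          cost κ (h ++ [(q, true)])) +
      weight p (h ++ [(q, false)]) *
        (Real.log (weight p (h ++ [(q, false)]) / weight p' (h ++ [(q, false)])) -
          cost κ (h ++ [(q, false)])) ≤
      weight p h * (Real.log (weight p h / weight p' h) - cost κ h) := by
  have hw0 := weight_nonneg p h
  simp only [cost_append]
  by_cases hq : ∃ b, (q, b) ∈ h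
  · obtain ⟨b, hb⟩ := hq
    obtain ⟨h1, h2⟩ := weight_append_of_mem p h q hb
    obtain ⟨h1', h2'⟩ := weight_append_of_mem p' h q hb
    have := mul_nonneg hw0 (hκ q.2)
    cases b
    · simp only [Bool.not_false] at h2 h2'
      rw [h1, h1', h2, h2']
      nlinarith
    · simp only [Bool.not_true] at h2 h2'
      rw [h1, h1', h2, h2']
      nlinarith
  · push Not at hq
    rw [weight_append_of_notMem p h q hq, weight_append_of_notMem p h q hq,
      weight_append_of_notMem p' h q hq, weight_append_of_notMem p' h q hq]
    rcases hw0.eq_or_lt with hw | hw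
    · simp [← hw]
    -- The entropy of the new bit adds to the log-likelihood ratio and is paid for by its cost.
    have hw' : 0 < weight p' h := weight_pos hp' hw.ne'
    have hlog : ∀ b, Real.log (weight p h * bitProb (p q.2) b /
        (weight p' h * bitProb (p' q.2) b)) =
        Real.log (weight p h / weight p' h) +
          Real.log (bitProb (p q.2) b / bitProb (p' q.2) b) := by
      intro b
      rw [mul_div_mul_comm, Real.log_mul (div_pos hw hw').ne'
        (div_pos (hp _ _) (hp' _ _)).ne']
    rw [hlog, hlog]
    have hk := mul_le_mul_of_nonneg_left (hkl q.2) hw.le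
    have hs := bitProb_add (p q.2)
    have hf : bitProb (p q.2) false = 1 - bitProb (p q.2) true := by linarith
    rw [hf] at hk ⊢
    linarith

/-- A pointwise form of Pinsker's inequality, through `log r ≤ 2 (√r - 1)`. -/
lemma one_sub_le_add_div {r a : ℝ} (hr : 0 < r) (ha : 0 < a) :
    1 - r ≤ a + (r - 1 - Real.log r) / a := by
  set s := Real.sqrt r with hs
  have hs0 : 0 < s := Real.sqrt_pos.2 hr
  have hrs : r = s ^ 2 := (Real.sq_sqrt hr.le).symm
  have hlog : Real.log r ≤ 2 * (s - 1) := by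
    rw [hrs, Real.log_pow]
    have := Real.log_le_sub_one_of_pos hs0
    push_cast
    linarith
  have h1 : (1 - s) ^ 2 / a ≤ (r - 1 - Real.log r) / a := by
    gcongr
    nlinarith
  have h2 : 2 * (1 - s) ≤ a + (1 - s) ^ 2 / a := by
    rw [← sub_nonneg]
    have : a + (1 - s) ^ 2 / a - 2 * (1 - s) = (a - (1 - s)) ^ 2 / a := by
      field_simp; ring
    rw [this]
    positivity
  nlinarith [sq_nonneg (1 - s)]

/-- An event that depends on `n` steps of a deterministic strategy changes its probability, when the
biases change from `p` to `p'`, by at most what the expected cost of the queries under `p` pays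
for. -/
lemma measureReal_iterate_le {p p' : Fin m → unitInterval} {κ : Fin m → ℝ}
    (hp : ∀ c b, 0 < bitProb (p c) b) (hp' : ∀ c b, 0 < bitProb (p' c) b) (hκ : ∀ c, 0 ≤ κ c)
    (hkl : ∀ c, bitProb (p c) true * Real.log (bitProb (p c) true / bitProb (p' c) true) +
      bitProb (p c) false * Real.log (bitProb (p c) false / bitProb (p' c) false) ≤ κ c)
    {a : ℝ} (ha : 0 < a) (f : Transcript m → QueryAction m) (n : ℕ) (E : Set (Transcript m))
    (hE : MeasurableSet {ω | (advance f ω)^[n] [] ∈ E}) :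
    (oracleLaw p').real {ω | (advance f ω)^[n] [] ∈ E} ≤
      (oracleLaw p).real {ω | (advance f ω)^[n] [] ∈ E} + a +
        (∫ ω, cost κ ((advance f ω)^[n] []) ∂(oracleLaw p)) / a := by
  classical
  have hreal : ∀ p : Fin m → unitInterval,
      (oracleLaw p).real {ω | (advance f ω)^[n] [] ∈ E} =
        ∫ ω, E.indicator (fun _ => (1 : ℝ)) ((advance f ω)^[n] []) ∂(oracleLaw p) := by
    intro p
    rw [← integral_indicator_one hE]
    rfl
  have hsum : ∫ ω, (E.indicator (fun _ => (1 : ℝ)) ((advance f ω)^[n] []) +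
        cost κ ((advance f ω)^[n] []) / a) ∂(oracleLaw p) =
      (∫ ω, E.indicator (fun _ => (1 : ℝ)) ((advance f ω)^[n] []) ∂(oracleLaw p)) +
        (∫ ω, cost κ ((advance f ω)^[n] []) ∂(oracleLaw p)) / a := by
    rw [integral_add (integrable_iterate p f _ n)
      ((integrable_iterate p f (cost κ) n).div_const a), integral_div]
  suffices hmain : treeSum f n (fun h => weight p' h * E.indicator (fun _ => (1 : ℝ)) h) [] -
      treeSum f n (fun h => weight p h *
        (E.indicator (fun _ => (1 : ℝ)) h + cost κ h / a)) [] ≤ a by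
    rw [← integral_iterate, ← integral_iterate p f
      (fun h => E.indicator (fun _ => (1 : ℝ)) h + cost κ h / a), hsum] at hmain
    rw [hreal, hreal]
    linarith
  rw [← treeSum_sub]
  -- `X` is a martingale part plus the potential of `entropy_superharmonic`; Pinsker's inequality for
  -- the likelihood ratio at a leaf shows that it dominates the integrand.
  set X : Transcript m → ℝ := fun h =>
    (weight p' h - weight p h) * (1 + 1 / a) + a * weight p h +
      (weight p h * (Real.log (weight p h / weight p' h) - cost κ h)) / a with hX
  have hX0 : X [] = a := by simp [hX, cost]
  refine le_of_le_of_eq ((treeSum_mono f n (G := X) (fun h => ?_) []).trans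
    (treeSum_le_of_superharmonic f n (fun h q => ?_) [])) hX0
  · simp only [hX, Pi.sub_apply]
    rcases (weight_nonneg p h).eq_or_lt with hw | hw
    · have hw' : weight p' h = 0 := by
        by_contra hne
        exact (weight_pos hp hne).ne hw
      simp [← hw, hw']
    have hw' : 0 < weight p' h := weight_pos hp' hw.ne'
    obtain ⟨r, hr, hwr⟩ : ∃ r, 0 < r ∧ weight p' h = r * weight p h :=
      ⟨weight p' h / weight p h, div_pos hw' hw, by field_simp⟩
    have hlog : Real.log (weight p h / weight p' h) = - Real.log r := by
      rw [hwr, div_mul_cancel_right₀ hw.ne', Real.log_inv]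
    rw [hlog, hwr]
    have key : E.indicator (fun _ => (1 : ℝ)) h * (r - 1) ≤
        (r - 1) + a + (r - 1 - Real.log r) / a := by
      by_cases hh : h ∈ E
      · have h0 : 0 ≤ (r - 1 - Real.log r) / a :=
          div_nonneg (by linarith [Real.log_le_sub_one_of_pos hr]) ha.le
        simp only [hh, Set.indicator_of_mem]
        linarith
      · simp only [hh, not_false_eq_true, Set.indicator_of_notMem]
        linarith [one_sub_le_add_div hr ha]
    have := mul_le_mul_of_nonneg_left key hw.le
    have e : (r * weight p h - weight p h) * (1 + 1 / a) + a * weight p h +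
        weight p h * (-Real.log r - cost κ h) / a =
        weight p h * ((r - 1) + a + (r - 1 - Real.log r) / a) - weight p h * (cost κ h / a) := by
      field_simp; ring
    rw [e]
    linarith
  · have h1 := weight_append_add p h q
    have h2 := weight_append_add p' h q
    have h3 := div_le_div_of_nonneg_right (entropy_superharmonic hp hp' hκ hkl h q) ha.le
    simp only [hX]
    rw [add_div] at h3
    rw [← h1, ← h2] at *
    linarith

end ChangeOfMeasure

/-! ### Measurability of runs -/

section Measurability

variable {m : ℕ} (A : AdaptiveAlgorithm m)

lemma measurableSet_singleton_queryAction (a : QueryAction m) :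
    MeasurableSet ({a} : Set (QueryAction m)) := by
  cases a with
  | inl q => simpa using (measurableSet_singleton q).inl_image (β := Fin m)
  | inr c => simpa using (measurableSet_singleton c).inr_image (α := ℕ × Fin m)

lemma measurableSet_transcript_mem (n : ℕ) (E : Set (Transcript m)) :
    MeasurableSet {x : A.Seed × (ℕ → Fin m → Bool) | A.transcript x.1 x.2 n ∈ E} := by
  induction n generalizing E with
  | zero => simp [AdaptiveAlgorithm.transcript]
  | succ n ih =>
    have hset : {x : A.Seed × (ℕ → Fin m → Bool) | A.transcript x.1 x.2 (n + 1) ∈ E} =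
        ⋃ (h : Transcript m) (a : QueryAction m),
          {x | A.transcript x.1 x.2 n ∈ ({h} : Set (Transcript m))} ∩
            ({x | A.next x.1 h = a} ∩ {x | advance (fun _ => a) x.2 h ∈ E}) := by
      ext x
      simp only [Set.mem_iUnion, Set.mem_inter_iff, Set.mem_ofPred_eq, Set.mem_singleton_iff]
      exact ⟨fun hx => ⟨_, _, rfl, rfl, hx⟩, by rintro ⟨h, a, rfl, rfl, hx⟩; exact hx⟩
    rw [hset]
    refine MeasurableSet.iUnion fun h => MeasurableSet.iUnion fun a =>
      (ih _).inter (MeasurableSet.inter ?_ ?_)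
    · exact ((A.measurable_next h).comp measurable_fst) (measurableSet_singleton_queryAction a)
    · cases a with
      | inl q =>
        have : Measurable fun x : A.Seed × (ℕ → Fin m → Bool) => x.2 q.1 q.2 := by fun_prop
        exact this (MeasurableSet.of_discrete (s := {b | h ++ [(q, b)] ∈ E}))
      | inr c => exact MeasurableSet.const (h ∈ E)

lemma measurableSet_next_transcript (n : ℕ) (c : Fin m) :
    MeasurableSet {x : A.Seed × (ℕ → Fin m → Bool) |
      A.next x.1 (A.transcript x.1 x.2 n) = Sum.inr c} := by
  have hset : {x : A.Seed × (ℕ → Fin m → Bool) |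
      A.next x.1 (A.transcript x.1 x.2 n) = Sum.inr c} =
      ⋃ h : Transcript m, {x | A.transcript x.1 x.2 n ∈ ({h} : Set (Transcript m))} ∩
        {x | A.next x.1 h = Sum.inr c} := by
    ext x
    simp
  rw [hset]
  exact MeasurableSet.iUnion fun h => (measurableSet_transcript_mem A n _).inter
    (((A.measurable_next h).comp measurable_fst) (measurableSet_singleton_queryAction _))

/-- Every function of the `n`-step transcript is measurable, as there are only countably many
transcripts. -/
lemma measurable_comp_transcript {β : Type*} [MeasurableSpace β] (n : ℕ) (G : Transcript m → β) :
    Measurable fun x : A.Seed × (ℕ → Fin m → Bool) => G (A.transcript x.1 x.2 n) :=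
  fun S _ => measurableSet_transcript_mem A n (G ⁻¹' S)

end Measurability

/-! ### Randomized algorithms on product instances -/

section Randomized

variable {m : ℕ}

lemma cost_nonneg {κ : Fin m → ℝ} (hκ : ∀ c, 0 ≤ κ c) (h : Transcript m) : 0 ≤ cost κ h := by
  refine List.sum_nonneg fun y hy => ?_
  obtain ⟨x, -, rfl⟩ := List.mem_map.1 hy
  exact hκ _

lemma sum_cost_single (κ₀ : ℝ) (h : Transcript m) :
    ∑ c, cost (Pi.single c κ₀) h = κ₀ * h.length := by
  induction h with
  | nil => simp [cost]
  | cons x h ih =>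
    have : ∀ c, cost (Pi.single c κ₀) (x :: h) =
        (Pi.single c κ₀ : Fin m → ℝ) x.1.2 + cost (Pi.single c κ₀) h := fun c => by simp [cost]
    simp only [this, Finset.sum_add_distrib, ih, Pi.single_apply, Finset.sum_ite_eq,
      Finset.mem_univ, if_true, List.length_cons]
    push_cast
    ring

/-- The change-of-measure bound for randomized algorithms: the bound for deterministic strategies
is linear in the probabilities and the expected cost, so it can be averaged over the seed. -/
lemma prod_measure_stops_le {p p' : Fin m → unitInterval} {κ : Fin m → ℝ}
    (hp : ∀ c b, 0 < bitProb (p c) b) (hp' : ∀ c b, 0 < bitProb (p' c) b) (hκ : ∀ c, 0 ≤ κ c)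
    (hkl : ∀ c, bitProb (p c) true * Real.log (bitProb (p c) true / bitProb (p' c) true) +
      bitProb (p c) false * Real.log (bitProb (p c) false / bitProb (p' c) false) ≤ κ c)
    {a : ℝ} (ha : 0 < a) (A : AdaptiveAlgorithm m) (n : ℕ) (c : Fin m) :
    (A.seedLaw.prod (oracleLaw p')) {x | A.next x.1 (A.transcript x.1 x.2 n) = Sum.inr c} ≤
      (A.seedLaw.prod (oracleLaw p)) {x | A.next x.1 (A.transcript x.1 x.2 n) = Sum.inr c} +
        ENNReal.ofReal a +
        ∫⁻ x, ENNReal.ofReal (cost κ (A.transcript x.1 x.2 n) / a)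
          ∂(A.seedLaw.prod (oracleLaw p)) := by
  have hR := measurableSet_next_transcript A n c
  have hcost := measurable_comp_transcript A n fun h => ENNReal.ofReal (cost κ h / a)
  rw [Measure.prod_apply hR, Measure.prod_apply hR, lintegral_prod _ hcost.aemeasurable]
  have hconst : ENNReal.ofReal a = ∫⁻ _, ENNReal.ofReal a ∂A.seedLaw := by simp
  rw [hconst, ← lintegral_add_right _ measurable_const,
    ← lintegral_add_right _ hcost.lintegral_prod_right']
  refine lintegral_mono fun s => ?_
  have hE : MeasurableSet {ω | (advance (A.next s) ω)^[n] [] ∈ {h | A.next s h = Sum.inr c}} := by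
    have := measurable_prodMk_left (x := s) hR
    simpa [AdaptiveAlgorithm.transcript_eq_iterate] using this
  have key := measureReal_iterate_le hp hp' hκ hkl ha (A.next s) n
    {h | A.next s h = Sum.inr c} hE
  have hint : ∫⁻ ω, ENNReal.ofReal (cost κ (A.transcript s ω n) / a) ∂(oracleLaw p) =
      ENNReal.ofReal ((∫ ω, cost κ ((advance (A.next s) ω)^[n] []) ∂(oracleLaw p)) / a) := by
    rw [← integral_div, ofReal_integral_eq_lintegral_ofReal]
    · simp only [AdaptiveAlgorithm.transcript_eq_iterate]
    · exact (integrable_iterate p (A.next s) (cost κ) n).div_const a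
    · exact ae_of_all _ fun ω => div_nonneg (cost_nonneg hκ _) ha.le
  have h0 : 0 ≤ (∫ ω, cost κ ((advance (A.next s) ω)^[n] []) ∂(oracleLaw p)) / a :=
    div_nonneg (integral_nonneg fun ω => cost_nonneg hκ _) ha.le
  have key' := ENNReal.ofReal_le_ofReal key
  rw [ENNReal.ofReal_add (by positivity) h0, ENNReal.ofReal_add (by positivity) ha.le,
    ofReal_measureReal, ofReal_measureReal] at key'
  simp only [hint]
  simpa [Set.preimage, AdaptiveAlgorithm.transcript_eq_iterate] using key'

lemma transcript_succ_of_stops (A : AdaptiveAlgorithm m) (s : A.Seed) (ω : ℕ → Fin m → Bool)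
    {n : ℕ} {c : Fin m} (h : A.next s (A.transcript s ω n) = Sum.inr c) :
    A.transcript s ω (n + 1) = A.transcript s ω n := by
  simp [AdaptiveAlgorithm.transcript, h]

lemma monotone_stops (A : AdaptiveAlgorithm m) (c : Fin m) :
    Monotone fun n => {x : A.Seed × (ℕ → Fin m → Bool) |
      A.next x.1 (A.transcript x.1 x.2 n) = Sum.inr c} := by
  refine monotone_nat_of_le_succ fun n x hx => ?_
  have : A.next x.1 (A.transcript x.1 x.2 n) = Sum.inr c := hx
  simpa only [Set.mem_ofPred_eq, transcript_succ_of_stops A x.1 x.2 this] using this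

/-- The instance whose experts answer independently, expert `c` with bias `p c`. -/
noncomputable def productInstance (p : Fin m → unitInterval) : BinaryInstance m where
  Task := Fin m → Bool
  taskLaw := Measure.pi fun c => ProbabilityTheory.bernoulliMeasure true false (p c)
  u := id
  measurable_u := fun c => measurable_pi_apply c

lemma runLaw_productInstance (A : AdaptiveAlgorithm m) (p : Fin m → unitInterval) :
    A.runLaw (productInstance p) = A.seedLaw.prod (oracleLaw p) := rfl

lemma coverage_productInstance (p : Fin m → unitInterval) (c : Fin m) :
    (productInstance p).coverage {c} = p c := by
  have hset : {d : Fin m → Bool | ∃ c' ∈ ({c} : Finset (Fin m)), d c' = true} =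
      (fun d : Fin m → Bool => d c) ⁻¹' {true} := by
    ext d; simp
  change (Measure.pi fun c => ProbabilityTheory.bernoulliMeasure true false (p c)).real
    {d : Fin m → Bool | ∃ c' ∈ ({c} : Finset (Fin m)), d c' = true} = _
  rw [hset, measureReal_def,
    (measurePreserving_eval (fun c => ProbabilityTheory.bernoulliMeasure true false (p c))
      c).measure_preimage (measurableSet_singleton true).nullMeasurableSet, ← measureReal_def,
    bernoulliMeasure_real_singleton]
  simp [bitProb]

lemma BinaryInstance.coverage_le_opt_one (I : BinaryInstance m) (c : Fin m) :
    I.coverage {c} ≤ I.opt 1 :=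
  le_ciSup (f := fun S : {S : Finset (Fin m) // S.card = 1} => I.coverage S.1)
    (Set.finite_range _).bddAbove ⟨{c}, Finset.card_singleton c⟩

lemma lintegral_length_le_worstCaseQueries (A : AdaptiveAlgorithm m) (p : Fin m → unitInterval)
    (n : ℕ) :
    ∫⁻ x, ((A.transcript x.1 x.2 n).length : ℝ≥0∞) ∂(A.seedLaw.prod (oracleLaw p)) ≤
      A.worstCaseQueries := by
  refine le_trans ?_ (le_iSup (fun I => A.expectedQueries I) (productInstance p))
  rw [AdaptiveAlgorithm.expectedQueries, runLaw_productInstance]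
  exact lintegral_mono fun x =>
    le_iSup (fun n => ((A.transcript x.1 x.2 n).length : ℝ≥0∞)) n

end Randomized

/-! ### One expert hidden among fair coins -/

section HiddenExpert

variable {m : ℕ}

/-- The bias of a fair coin. -/
noncomputable def fairBias : unitInterval := ⟨1 / 2, by norm_num, by norm_num⟩

/-- The biases for which expert `c` has bias `q` and all other experts are fair coins. -/
noncomputable def hiddenBias (q : unitInterval) (c : Fin m) : Fin m → unitInterval :=
  Function.update (fun _ => fairBias) c q

lemma bitProb_fairBias (b : Bool) : bitProb fairBias b = 1 / 2 := by
  cases b <;> norm_num [bitProb, fairBias]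

/-- The relative entropy of a fair bit with respect to a bit of bias `1 / 2 + 2 * ε` is of order
`ε ^ 2`. -/
lemma klBit_le {q : unitInterval} {ε : ℝ} (hε : 0 < ε) (hε' : ε ≤ 1 / 8)
    (hq : (q : ℝ) = 1 / 2 + 2 * ε) :
    bitProb fairBias true * Real.log (bitProb fairBias true / bitProb q true) +
      bitProb fairBias false * Real.log (bitProb fairBias false / bitProb q false) ≤
      11 * ε ^ 2 := by
  have hsq : ε ^ 2 ≤ 1 / 64 := by nlinarith
  have h1 : bitProb q true = 1 / 2 + 2 * ε := by simp [bitProb, hq]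
  have h2 : bitProb q false = 1 / 2 - 2 * ε := by simp [bitProb, hq]; ring
  have hden : 0 < 1 - 16 * ε ^ 2 := by linarith
  rw [bitProb_fairBias, bitProb_fairBias, h1, h2, ← mul_add,
    ← Real.log_mul (by positivity) (div_pos (by norm_num) (by linarith)).ne']
  have e : 1 / 2 / (1 / 2 + 2 * ε) * (1 / 2 / (1 / 2 - 2 * ε)) = 1 / (1 - 16 * ε ^ 2) := by
    rw [div_mul_div_comm, show (1 / 2 + 2 * ε) * (1 / 2 - 2 * ε) = (1 - 16 * ε ^ 2) / 4 by ring]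
    field_simp
    norm_num
  rw [e]
  have hl := Real.log_le_sub_one_of_pos (x := 1 / (1 - 16 * ε ^ 2)) (by positivity)
  have hb : 1 / (1 - 16 * ε ^ 2) - 1 ≤ 22 * ε ^ 2 := by
    rw [sub_le_iff_le_add, div_le_iff₀ hden]
    nlinarith [sq_nonneg ε]
  linarith

lemma eq_of_opt_one_sub_le_coverage {q : unitInterval} {ε : ℝ} (hε : 0 < ε)
    (hq : (q : ℝ) = 1 / 2 + 2 * ε) {c c' : Fin m}
    (h : (productInstance (hiddenBias q c)).opt 1 - ε ≤
      (productInstance (hiddenBias q c)).coverage {c'}) : c' = c := by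
  by_contra hne
  have h1 := (productInstance (hiddenBias q c)).coverage_le_opt_one c
  rw [coverage_productInstance] at h h1
  have e1 : hiddenBias q c c = q := by simp [hiddenBias]
  have e2 : (hiddenBias q c c' : ℝ) = 1 / 2 := by simp [hiddenBias, hne, fairBias]
  rw [e2] at h
  rw [e1, hq] at h1
  linarith

/-- A successful algorithm finds the hidden expert within a bounded number of steps, at the
price of lowering the success probability from `2 / 3` to `5 / 8`. The bound `n` serves all hidden
experts at once. -/
lemma exists_forall_measure_stops_ge (A : AdaptiveAlgorithm m) {q : unitInterval} {ε : ℝ}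
    (hε : 0 < ε) (hq : (q : ℝ) = 1 / 2 + 2 * ε)
    (hA : ∀ I : BinaryInstance m, 2 / 3 ≤ A.successProb I ε) :
    ∃ n, ∀ c, ENNReal.ofReal (5 / 8) ≤ (A.seedLaw.prod (oracleLaw (hiddenBias q c)))
      {x | A.next x.1 (A.transcript x.1 x.2 n) = Sum.inr c} := by
  suffices h : ∀ c : Fin m, ∀ᶠ n in Filter.atTop,
      ENNReal.ofReal (5 / 8) ≤ (A.seedLaw.prod (oracleLaw (hiddenBias q c)))
        {x | A.next x.1 (A.transcript x.1 x.2 n) = Sum.inr c} from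
    (Filter.eventually_all.2 h).exists
  intro c
  have hlim := tendsto_measure_iUnion_atTop (μ := A.seedLaw.prod (oracleLaw (hiddenBias q c)))
    (monotone_stops A c)
  refine (hlim.eventually_const_lt ?_).mono fun n hn => hn.le
  have hs := hA (productInstance (hiddenBias q c))
  have hsub : A.successProb (productInstance (hiddenBias q c)) ε ≤
      (A.seedLaw.prod (oracleLaw (hiddenBias q c))).real
        (⋃ n, {x | A.next x.1 (A.transcript x.1 x.2 n) = Sum.inr c}) := by
    rw [AdaptiveAlgorithm.successProb, runLaw_productInstance]
    refine measureReal_mono ?_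
    rintro x ⟨c', ⟨n, hn⟩, hc'⟩
    obtain rfl := eq_of_opt_one_sub_le_coverage hε hq hc'
    exact Set.mem_iUnion.2 ⟨n, hn⟩
  rw [← ofReal_measureReal]
  exact (ENNReal.ofReal_lt_ofReal_iff (by linarith)).2 (by linarith)

end HiddenExpert

/-! ### The lower bound -/

theorem theorem4p2 :
    ∃ K : ℝ, 0 < K ∧ ∀ (m : ℕ) (ε : ℝ) (A : AdaptiveAlgorithm m),
      2 ≤ m → 0 < ε → ε ≤ 1 / 8 →
      (∀ I : BinaryInstance m, 2 / 3 ≤ A.successProb I ε) →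
      ENNReal.ofReal (K * (m / ε ^ 2)) ≤ A.worstCaseQueries := by
  -- With `a = 1 / 16` and cost `11 * ε ^ 2` per query, the bounds for all hidden experts sum to
  -- `5 / 8 * m ≤ 1 + m / 16 + 16 * 11 * ε ^ 2 * w` for the query complexity `w`; as `1 ≤ m / 2`,
  -- this leaves `m / 16 ≤ 176 * ε ^ 2 * w`, and `2816 = 16 * 176`.
  refine ⟨1 / 2816, by norm_num, fun m ε A hm hε hε' hA => ?_⟩
  obtain ⟨q, hq⟩ : ∃ q : unitInterval, (q : ℝ) = 1 / 2 + 2 * ε :=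
    ⟨⟨1 / 2 + 2 * ε, by linarith, by linarith⟩, rfl⟩
  obtain ⟨n, hn⟩ := exists_forall_measure_stops_ge A hε hq hA
  have hfair : ∀ (c : Fin m) b, 0 < bitProb ((fun _ => fairBias : Fin m → unitInterval) c) b :=
    fun c b => by norm_num [bitProb_fairBias]
  have hhid : ∀ (c j : Fin m) b, 0 < bitProb (hiddenBias q c j : unitInterval) b := by
    intro c j b
    by_cases hj : j = c
    · subst hj
      cases b <;> simp only [hiddenBias, Function.update_self, bitProb, hq] <;> norm_num <;>
        linarith
    · simp [hiddenBias, hj, bitProb_fairBias]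
  set μ := A.seedLaw.prod (oracleLaw (fun _ : Fin m => fairBias)) with hμ
  set R : Fin m → Set (A.Seed × (ℕ → Fin m → Bool)) :=
    fun c => {x | A.next x.1 (A.transcript x.1 x.2 n) = Sum.inr c} with hR
  have hκ : ∀ c j : Fin m, 0 ≤ (Pi.single c (11 * ε ^ 2) : Fin m → ℝ) j := fun c j => by
    rw [Pi.single_apply]; positivity
  have hc : ∀ c, ENNReal.ofReal (5 / 8) ≤ μ (R c) + ENNReal.ofReal (1 / 16) +
      ∫⁻ x, ENNReal.ofReal (cost (Pi.single c (11 * ε ^ 2)) (A.transcript x.1 x.2 n) / (1 / 16))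
        ∂μ := by
    intro c
    refine (hn c).trans (prod_measure_stops_le hfair (hhid c) (hκ c) (fun j => ?_)
      (by norm_num) A n c)
    by_cases hj : j = c
    · subst hj
      simpa [hiddenBias] using klBit_le hε hε' hq
    · simp [hiddenBias, hj, bitProb_fairBias]
  have hdisj : ∑ c, μ (R c) ≤ 1 := by
    rw [← measure_univ (μ := μ)]
    refine sum_measure_le_measure_univ
      (fun c _ => (measurableSet_next_transcript A n c).nullMeasurableSet) ?_
    intro c _ c' _ hne
    refine Disjoint.aedisjoint (Set.disjoint_left.2 fun x hx hx' => hne ?_)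
    exact Sum.inr_injective (Eq.trans (Eq.symm hx) hx')
  have hcost : ∑ c, ∫⁻ x, ENNReal.ofReal
        (cost (Pi.single c (11 * ε ^ 2)) (A.transcript x.1 x.2 n) / (1 / 16)) ∂μ ≤
      ENNReal.ofReal (176 * ε ^ 2) * A.worstCaseQueries := by
    rw [← lintegral_finsetSum _ fun c _ => measurable_comp_transcript A n fun h =>
      ENNReal.ofReal (cost (Pi.single c (11 * ε ^ 2)) h / (1 / 16))]
    refine le_trans (le_of_eq ?_) (mul_le_mul_right
      (lintegral_length_le_worstCaseQueries A (fun _ => fairBias) n) _)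
    rw [← lintegral_const_mul _ (measurable_comp_transcript A n fun h => (h.length : ℝ≥0∞))]
    refine lintegral_congr fun x => ?_
    rw [← ENNReal.ofReal_sum_of_nonneg fun c _ =>
      div_nonneg (cost_nonneg (hκ c) _) (by norm_num), ← Finset.sum_div, sum_cost_single,
      ← ENNReal.ofReal_natCast, ← ENNReal.ofReal_mul (by positivity)]
    congr 1
    ring
  have hsum := Finset.sum_le_sum fun c (_ : c ∈ Finset.univ) => hc c
  rw [Finset.sum_add_distrib, Finset.sum_add_distrib] at hsum
  have htotal := hsum.trans (add_le_add (add_le_add_left hdisj _) hcost)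
  rcases eq_or_ne A.worstCaseQueries ⊤ with htop | htop
  · rw [htop]; exact le_top
  obtain ⟨w, hw0, hw⟩ : ∃ w : ℝ, 0 ≤ w ∧ A.worstCaseQueries = ENNReal.ofReal w :=
    ⟨_, ENNReal.toReal_nonneg, (ENNReal.ofReal_toReal htop).symm⟩
  rw [hw] at htotal ⊢
  simp only [Finset.sum_const, Finset.card_univ, Fintype.card_fin, nsmul_eq_mul] at htotal
  rw [← ENNReal.ofReal_natCast, ← ENNReal.ofReal_one, ← ENNReal.ofReal_mul (by positivity),
    ← ENNReal.ofReal_mul (by positivity), ← ENNReal.ofReal_mul (by positivity),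
    ← ENNReal.ofReal_add (by positivity) (by positivity),
    ← ENNReal.ofReal_add (by positivity) (by positivity),
    ENNReal.ofReal_le_ofReal_iff (by positivity)] at htotal
  refine ENNReal.ofReal_le_ofReal ?_
  have hm' : (2 : ℝ) ≤ m := by exact_mod_cast hm
  rw [← mul_div_assoc, div_le_iff₀ (by positivity)]
  linarith
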